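/- Let $K$ be an ordered field and let $R$ be its real closure, that is, a real closed field, algebraic over $K$, whose order extends that of $K$. Suppose that $K$ is square-dense in $R$: for all $a, b \in R$, if there is $c \in K$ with $0 < a < c < b$, then there is $d \in K$ with $a < d^2 < b$. Let $L$ be the topological closure of $K$ in $R$ with respect to the order topology of $R$. Then $L$ is a subfield of $R$ containing $K$; it is algebraic over $K$; with the order inherited from $R$ it is an ordered field extending the ordered field $K$, and it is Euclidean, i.e. every positive element of $L$ has a square root in $L$; and $K$ is topologically dense in $L$, i.e. every non-empty open interval of $L$ contains an element of $K$. In particular, every ordered field $K$ that is square-dense in its real closure has an algebraic extension which is an ordered Euclidean field and in which $K$ is topologically dense. -/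

import Mathlib

/-- `R` is a real closure of the ordered field `K`: it is real closed, algebraic over `K`, and its
order extends the order of `K`. -/
structure IsOrderedRealClosure (K R : Type*) [Field K] [LinearOrder K] [IsStrictOrderedRing K]
    [Field R] [LinearOrder R] [IsStrictOrderedRing R] [Algebra K R] : Prop where
  isRealClosed : IsRealClosed R
  isAlgebraic : Algebra.IsAlgebraic K R
  strictMono : StrictMono (algebraMap K R)

/-- `F` is square-dense in the ordered extension field `E`: every `E`-interval of positive elements
that contains an element of `F` contains the square of an element of `F`. -/
def IsSquareDenseIn (F E : Type*) [Field F] [Field E] [LinearOrder E] [Algebra F E] : Prop :=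
  ∀ a b : E, (∃ c : F, 0 < a ∧ a < algebraMap F E c ∧ algebraMap F E c < b) →
    ∃ d : F, a < algebraMap F E d ^ 2 ∧ algebraMap F E d ^ 2 < b

/-- `F` is topologically dense in the ordered extension field `E`: every non-empty open interval
of `E` contains an element of `F`. -/
def IsTopologicallyDenseIn (F E : Type*) [Field F] [Field E] [LinearOrder E] [Algebra F E] : Prop :=
  ∀ a b : E, (Set.Ioo a b).Nonempty → ∃ c : F, algebraMap F E c ∈ Set.Ioo a b

/-- `F` is an ordered Euclidean field: a linearly ordered field in which every positive element has
a square root. -/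
structure IsOrderedEuclideanField (F : Type*) [Field F] [LinearOrder F] : Prop where
  isStrictOrderedRing : IsStrictOrderedRing F
  exists_sqrt : ∀ q : F, 0 < q → ∃ r : F, r ^ 2 = q

/-! The closure of a subfield is a subfield, and `K` is dense in it because intervals of `L` are
traces of intervals of `R`. Only square roots need square-density: if `s > 0` and `s ^ 2` is a limit
of `K`, squaring a small positive interval around `s` gives one that meets `K`, hence contains some
`d ^ 2` with `d` in `K`; then `|d|` is close to `s`. -/

/-- The topological closure of `K` in a topological extension field, as an intermediate field. -/
def IntermediateField.closureBot (K R : Type*) [Field K] [Field R] [TopologicalSpace R]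
    [IsTopologicalDivisionRing R] [Algebra K R] : IntermediateField K R :=
  (algebraMap K R).fieldRange.topologicalClosure.toIntermediateField fun x =>
    subset_closure ⟨x, rfl⟩

theorem IntermediateField.coe_closureBot (K R : Type*) [Field K] [Field R] [TopologicalSpace R]
    [IsTopologicalDivisionRing R] [Algebra K R] :
    (IntermediateField.closureBot K R : Set R) = closure (Set.range (algebraMap K R)) := by
  change closure ((algebraMap K R).fieldRange : Set R) = _
  rw [RingHom.coe_fieldRange]

/-- If `K` is square-dense in `R`, then a positive element of `R` whose square lies in the closure
of `K` lies in the closure of `K`. -/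
theorem IsSquareDenseIn.mem_closure_of_sq_mem_closure {K R : Type*} [Field K] [Field R]
    [LinearOrder R] [IsStrictOrderedRing R] [TopologicalSpace R] [OrderTopology R] [Algebra K R]
    (hK : IsSquareDenseIn K R) {s : R} (hs : 0 < s)
    (hq : s ^ 2 ∈ closure (Set.range (algebraMap K R))) :
    s ∈ closure (Set.range (algebraMap K R)) := by
  rw [mem_closure_iff_nhds_basis (nhds_basis_Ioo s)]
  rintro ⟨u, v⟩ ⟨hu, hv⟩
  -- `u` may be negative; a positive left endpoint `w` makes `w ^ 2 < s ^ 2` and meets the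
  -- positivity condition in `hK`.
  obtain ⟨w, hw, hws⟩ := exists_between (max_lt hu hs)
  obtain ⟨huw, hw0⟩ := max_lt_iff.1 hw
  have hv0 : 0 < v := hs.trans hv
  obtain ⟨_, ⟨c, rfl⟩, hc₁, hc₂⟩ := (mem_closure_iff_nhds_basis (nhds_basis_Ioo (s ^ 2))).1 hq
    (w ^ 2, v ^ 2) ⟨pow_lt_pow_left₀ hws hw0.le two_ne_zero, pow_lt_pow_left₀ hv hs.le two_ne_zero⟩
  obtain ⟨d, hd₁, hd₂⟩ := hK (w ^ 2) (v ^ 2) ⟨c, pow_pos hw0 2, hc₁, hc₂⟩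
  have h₁ : w < |algebraMap K R d| := by simpa [abs_of_pos hw0] using sq_lt_sq.1 hd₁
  have h₂ : |algebraMap K R d| < v := by simpa [abs_of_pos hv0] using sq_lt_sq.1 hd₂
  refine ⟨|algebraMap K R d|, ?_, huw.trans h₁, h₂⟩
  rcases abs_choice (algebraMap K R d) with h | h
  · exact ⟨d, h.symm⟩
  · exact ⟨-d, by rw [map_neg, h]⟩

/-- The order on `L` is the one inherited from `R`. -/
theorem mainTheorem1 {K R : Type*} [Field K] [LinearOrder K] [IsStrictOrderedRing K]
    [Field R] [LinearOrder R] [IsStrictOrderedRing R] [TopologicalSpace R] [OrderTopology R]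
    [Algebra K R] (hR : IsOrderedRealClosure K R) (hK : IsSquareDenseIn K R) :
    ∃ L : IntermediateField K R,
      (L : Set R) = closure (Set.range (algebraMap K R)) ∧
      Algebra.IsAlgebraic K L ∧
      StrictMono (algebraMap K L) ∧
      IsOrderedEuclideanField L ∧
      IsTopologicallyDenseIn K L := by
  have := hR.isRealClosed
  have := hR.isAlgebraic
  have hmem (x : R) : x ∈ IntermediateField.closureBot K R ↔
      x ∈ closure (Set.range (algebraMap K R)) := by
    rw [← IntermediateField.coe_closureBot, SetLike.mem_coe]
  refine ⟨IntermediateField.closureBot K R, IntermediateField.coe_closureBot K R, inferInstance,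
    fun _ _ h => hR.strictMono h, ⟨inferInstance, ?_⟩, ?_⟩
  · rintro ⟨q, hq⟩ hq0
    have hq0 : 0 < q := hq0
    obtain ⟨r, hr⟩ := IsRealClosed.exists_eq_pow_of_nonneg hq0.le two_ne_zero
    have hr0 : r ≠ 0 := by
      rintro rfl
      simp [hr] at hq0
    have hs : |r| ^ 2 = q := by rw [sq_abs, hr]
    refine ⟨⟨|r|, (hmem _).2 (hK.mem_closure_of_sq_mem_closure (abs_pos.2 hr0) ?_)⟩,
      Subtype.ext hs⟩
    rw [hs]
    exact (hmem q).1 hq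
  · rintro a b ⟨c, hac, hcb⟩
    obtain ⟨_, ⟨⟨hd₁, hd₂⟩, d, rfl⟩⟩ := mem_closure_iff.1 ((hmem c).1 c.2)
      (Set.Ioo (a : R) b) isOpen_Ioo ⟨hac, hcb⟩
    exact ⟨d, hd₁, hd₂⟩
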